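/- Let $R$ be a commutative ring with identity. For a finite sequence $\underline{x}=x_1,\dots,x_r$ in $R$ let $\mathbb{K}_\bullet(\underline{x})$ be its Koszul complex and let $H^i_{\underline{x}}(R)$ be the $i$-th cohomology of the Čech complex of $R$ with respect to $\underline{x}$. **Koszul grade.** If an ideal $\mathfrak{b}$ of $R$ is generated by $\underline{x}=x_1,\dots,x_r$, put $\operatorname{K.grade}_R(\mathfrak{b},R)=\inf\{i\ge 0 : H^i(\operatorname{Hom}_R(\mathbb{K}_\bullet(\underline{x}),R))\ne 0\}$, with $\inf\emptyset=+\infty$ (this does not depend on the choice of $\underline{x}$). For an arbitrary ideal $\mathfrak{a}$, $\operatorname{K.grade}_R(\mathfrak{a},R)$ is the supremum of $\operatorname{K.grade}_R(\mathfrak{b},R)$ over the finitely generated ideals $\mathfrak{b}\subseteq\mathfrak{a}$; for finitely generated $\mathfrak{a}$ the two definitions agree. The ring $R$ is *Cohen–Macaulay in the sense of finitely generated ideals* if $\operatorname{ht}(\mathfrak{a})=\operatorname{K.grade}_R(\mathfrak{a},R)$ for every finitely generated ideal $\mathfrak{a}$ of $R$ (where $\operatorname{ht}(R)=+\infty$).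 **Parameter sequences.** Write $\underline{x}^n=x_1^n,\dots,x_r^n$. For $m\ge n$ let $\varphi^m_n(\underline{x}):\mathbb{K}_\bullet(\underline{x}^m)\to\mathbb{K}_\bullet(\underline{x}^n)$ be the chain map $e_{s_1}\wedge\dots\wedge e_{s_i}\mapsto (x_{s_1}\cdots x_{s_i})^{m-n}\,e_{s_1}\wedge\dots\wedge e_{s_i}$. The sequence $\underline{x}$ is *weakly proregular* if for each $n>0$ there is $m\ge n$ such that the maps $H_i(\varphi^m_n(\underline{x})):H_i(\mathbb{K}_\bullet(\underline{x}^m))\to H_i(\mathbb{K}_\bullet(\underline{x}^n))$ are zero for all $i\ge1$. A sequence $\underline{x}=x_1,\dots,x_\ell$ is a *parameter sequence* on $R$ if it is weakly proregular, $(\underline{x})R\neq R$, and $H^\ell_{\underline{x}}(R)_{\mathfrak{p}}\ne0$ for every prime ideal $\mathfrak{p}\supseteq(\underline{x})R$. It is a *strong parameter sequence* on $R$ if $x_1,\dots,x_i$ is a parameter sequence on $R$ for every $1\le i\le\ell$. The ring $R$ is *Cohen–Macaulay in the sense of Hamilton–Marley* if every strong parameter sequence $x_1,\dots,x_\ell$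 ($\ell\ge1$) on $R$ is a regular sequence on $R$, i.e. $x_i$ is a nonzerodivisor on $R/(x_1,\dots,x_{i-1})R$ for $i=1,\dots,\ell$ and $(x_1,\dots,x_\ell)R\ne R$. **Theorem.** If $R$ is Cohen–Macaulay in the sense of finitely generated ideals, then $R$ is Cohen–Macaulay in the sense of Hamilton–Marley. -/

import Mathlib

open CategoryTheory

namespace NonNoetherianCM

universe u

/-! ### Signs -/

/-- The sign `(-1) ^ #{k ∈ S | k < j}` attached to the position of `j` in `S`. -/
def sgn {r : ℕ} (S : Finset (Fin r)) (j : Fin r) : ℤ :=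
  (-1) ^ (S.filter (· < j)).card

theorem sgn_swap_of_lt {r : ℕ} (S : Finset (Fin r)) {j k : Fin r} (hj : j ∈ S) (hlt : j < k) :
    sgn S j * sgn (S.erase j) k = -(sgn S k * sgn (S.erase k) j) := by
  have h1 : ((S.erase j).filter (· < k)) = (S.filter (· < k)).erase j := by
    ext a; simp only [Finset.mem_filter, Finset.mem_erase]; tauto
  have h2 : ((S.erase k).filter (· < j)) = S.filter (· < j) := by
    ext a
    simp only [Finset.mem_filter, Finset.mem_erase]
    constructor
    · tauto
    · rintro ⟨h, h'⟩
      exact ⟨⟨(h'.trans hlt).ne, h⟩, h'⟩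
  have hmem : j ∈ S.filter (· < k) := by simp [hj, hlt]
  have h3 := Finset.card_erase_add_one hmem
  unfold sgn
  rw [h1, h2, ← h3, pow_succ]
  ring

theorem sgn_swap {r : ℕ} (S : Finset (Fin r)) {j k : Fin r} (hj : j ∈ S) (hk : k ∈ S)
    (hne : j ≠ k) :
    sgn S j * sgn (S.erase j) k = -(sgn S k * sgn (S.erase k) j) := by
  rcases lt_or_gt_of_ne hne with h | h
  · exact sgn_swap_of_lt S hj h
  · rw [sgn_swap_of_lt S hk h, neg_neg]

/-- The sum over ordered pairs of distinct elements of `S` of a quantity that changes sign under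
the exchange of the two elements vanishes. -/
theorem sum_pairs_eq_zero {r : ℕ} {A : Type*} [AddCommGroup A] (S : Finset (Fin r))
    (F : (p : (j : S) × (S.erase j.1 : Finset (Fin r))) → A)
    (hF : ∀ (j k : Fin r) (hj : j ∈ S) (hk : k ∈ S) (h : k ∈ S.erase j) (h' : j ∈ S.erase k),
      F ⟨⟨j, hj⟩, ⟨k, h⟩⟩ + F ⟨⟨k, hk⟩, ⟨j, h'⟩⟩ = 0) :
    ∑ j : S, ∑ k : (S.erase j.1 : Finset (Fin r)), F ⟨j, k⟩ = 0 := by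
  rw [← Finset.sum_sigma Finset.univ (fun _ => Finset.univ) F]
  refine Finset.sum_involution
    (fun p _ => ⟨⟨p.2.1, Finset.mem_of_mem_erase p.2.2⟩,
      ⟨p.1.1, Finset.mem_erase.2 ⟨(Finset.ne_of_mem_erase p.2.2).symm, p.1.2⟩⟩⟩) ?_ ?_ ?_ ?_
  · rintro ⟨⟨j, hj⟩, ⟨k, hk⟩⟩ _
    exact hF j k hj _ hk _
  · rintro ⟨⟨j, hj⟩, ⟨k, hk⟩⟩ _ _ heq
    have : k = j := congrArg (fun q => q.1.1) heq
    exact Finset.ne_of_mem_erase hk this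
  · intro p _
    simp
  · rintro ⟨⟨j, hj⟩, ⟨k, hk⟩⟩ _
    rfl

/-! ### The Koszul complex -/

/-- The subsets of `{0, …, r-1}` with `i` elements. -/
abbrev Sub (r i : ℕ) : Type := {S : Finset (Fin r) // S.card = i}

/-- The subset `S` without its element `j`. -/
abbrev Sub.del {r i : ℕ} (S : Sub r (i + 1)) (j : S.1) : Sub r i :=
  ⟨S.1.erase j.1, by rw [Finset.card_erase_of_mem j.2, S.2]; rfl⟩

/-- The differential `K_{i+1}(x) → K_i(x)` of the Koszul complex; `K_i(x) = ⋀^i R^r` is the free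
module on the subsets `S` of size `i`
(the basis vector of `S = {s₁ < ⋯ < sᵢ}` being `e_{s₁} ∧ ⋯ ∧ e_{sᵢ}`). -/
noncomputable def koszulD {R : Type u} [CommRing R] {r : ℕ} (x : Fin r → R) (i : ℕ) :
    (Sub r (i + 1) →₀ R) →ₗ[R] (Sub r i →₀ R) :=
  Finsupp.linearCombination R fun S =>
    ∑ j : S.1, Finsupp.single (S.del j) ((sgn S.1 j.1 : R) * x j.1)

theorem koszulD_single {R : Type u} [CommRing R] {r : ℕ} (x : Fin r → R) (i : ℕ)
    (S : Sub r (i + 1)) (a : R) :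
    koszulD x i (Finsupp.single S a) =
      ∑ j : S.1, Finsupp.single (S.del j) (a * ((sgn S.1 j.1 : R) * x j.1)) := by
  simp only [koszulD, Finsupp.linearCombination_single, Finset.smul_sum, Finsupp.smul_single,
    smul_eq_mul]

theorem koszulD_comp {R : Type u} [CommRing R] {r : ℕ} (x : Fin r → R) (i : ℕ) :
    koszulD x i ∘ₗ koszulD x (i + 1) = 0 := by
  refine Finsupp.lhom_ext fun S a => ?_
  simp only [LinearMap.comp_apply, koszulD_single, map_sum, LinearMap.zero_apply]
  refine sum_pairs_eq_zero S.1 (fun p => Finsupp.single ((S.del p.1).del p.2)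
    (a * ((sgn S.1 p.1.1 : R) * x p.1.1) * ((sgn (S.1.erase p.1.1) p.2.1 : R) * x p.2.1))) ?_
  intro j k hj hk h h'
  have he : (S.del ⟨j, hj⟩).del ⟨k, h⟩ = (S.del ⟨k, hk⟩).del ⟨j, h'⟩ :=
    Subtype.ext (Finset.erase_right_comm)
  have hs := congrArg (Int.cast : ℤ → R)
    (sgn_swap S.1 hj hk (Finset.ne_of_mem_erase h).symm)
  push_cast at hs
  simp only [he]
  rw [← Finsupp.single_add]
  rw [Finsupp.single_eq_zero]
  linear_combination (a * x j * x k) * hs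

/-- The Koszul complex `K_•(x)` of a finite sequence `x` of elements of `R`. -/
noncomputable abbrev koszulComplex {R : Type u} [CommRing R] {r : ℕ} (x : Fin r → R) :
    ChainComplex (ModuleCat.{u} R) ℕ :=
  ChainComplex.of (fun i => ModuleCat.of R (Sub r i →₀ R))
    (fun i => ModuleCat.ofHom (koszulD x i))
    (fun i => by rw [← ModuleCat.ofHom_comp, koszulD_comp]; rfl)

theorem koszulComplex_d {R : Type u} [CommRing R] {r : ℕ} (x : Fin r → R) (i : ℕ) :
    (koszulComplex x).d (i + 1) i = ModuleCat.ofHom (koszulD x i) :=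
  ChainComplex.of_d (fun i => ModuleCat.of R (Sub r i →₀ R))
    (fun i => ModuleCat.ofHom (koszulD x i)) i

/-- The component in degree `i` of the comparison map `K_•(x^m) → K_•(x^n)`: multiplication by
`(∏_{j ∈ S} x_j)^{m-n}` on the basis vector of `S`. -/
noncomputable def koszulPowLin {R : Type u} [CommRing R] {r : ℕ} (x : Fin r → R) (n m i : ℕ) :
    (Sub r i →₀ R) →ₗ[R] (Sub r i →₀ R) :=
  Finsupp.linearCombination R fun S => Finsupp.single S ((∏ j ∈ S.1, x j) ^ (m - n))

theorem koszulPowLin_single {R : Type u} [CommRing R] {r : ℕ} (x : Fin r → R) (n m i : ℕ)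
    (S : Sub r i) (a : R) :
    koszulPowLin x n m i (Finsupp.single S a) =
      Finsupp.single S (a * (∏ j ∈ S.1, x j) ^ (m - n)) := by
  simp [koszulPowLin, Finsupp.linearCombination_single]

theorem koszulPowLin_comm {R : Type u} [CommRing R] {r : ℕ} (x : Fin r → R) {n m : ℕ}
    (h : n ≤ m) (i : ℕ) :
    koszulD (x ^ n) i ∘ₗ koszulPowLin x n m (i + 1) =
      koszulPowLin x n m i ∘ₗ koszulD (x ^ m) i := by
  refine Finsupp.lhom_ext fun S a => ?_
  simp only [LinearMap.comp_apply, koszulD_single, koszulPowLin_single, map_sum]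
  refine Finset.sum_congr rfl fun j _ => ?_
  congr 1
  obtain ⟨c, rfl⟩ := Nat.exists_eq_add_of_le h
  have hp : x j.1 * ∏ k ∈ S.1.erase j.1, x k = ∏ k ∈ S.1, x k :=
    Finset.mul_prod_erase S.1 x j.2
  simp only [Pi.pow_apply, Nat.add_sub_cancel_left, ← hp, mul_pow, pow_add]
  ring

/-- The comparison map `φ^m_n(x) : K_•(x^m) → K_•(x^n)` for `n ≤ m`, i.e. the tensor product over
`j` of the maps `K_•(x_j^m) → K_•(x_j^n)` that are the identity in degree `0` and multiplication
by `x_j^{m-n}` in degree `1`. -/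
noncomputable def koszulPowMap {R : Type u} [CommRing R] {r : ℕ} (x : Fin r → R) {n m : ℕ}
    (h : n ≤ m) : koszulComplex (x ^ m) ⟶ koszulComplex (x ^ n) :=
  ChainComplex.ofHom (fun i => ModuleCat.ofHom (koszulPowLin x n m i))
    (fun i => by
      rw [koszulComplex_d, koszulComplex_d, ← ModuleCat.ofHom_comp, ← ModuleCat.ofHom_comp,
        koszulPowLin_comm x h])

/-! ### The Koszul grade -/

/-- The Koszul cohomology `H^i(Hom_R(K_•(x), M))`. -/
noncomputable abbrev koszulCohomology {R : Type u} [CommRing R] {r : ℕ} (x : Fin r → R)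
    (M : Type u) [AddCommGroup M] [Module R M] (i : ℕ) : ModuleCat.{u} R :=
  ((koszulComplex x).linearYonedaObj R (ModuleCat.of R M)).homology i

/-- `inf {i | H^i(Hom_R(K_•(x), M)) ≠ 0}`, with `inf ∅ = ∞`: the Koszul grade on `M` of the ideal
generated by the finite sequence `x`. -/
noncomputable def koszulGradeSeq {R : Type u} [CommRing R] {r : ℕ} (x : Fin r → R)
    (M : Type u) [AddCommGroup M] [Module R M] : ℕ∞ :=
  ⨅ (i : ℕ) (_ : Nontrivial (koszulCohomology x M i)), (i : ℕ∞)

/-- The Koszul grade of an arbitrary ideal `𝔞` on `M`: the supremum of the Koszul grades of the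
finitely generated subideals of `𝔞`, each presented by a finite generating sequence `x`. -/
noncomputable def koszulGrade {R : Type u} [CommRing R] (𝔞 : Ideal R)
    (M : Type u) [AddCommGroup M] [Module R M] : ℕ∞ :=
  ⨆ (r : ℕ) (x : Fin r → R) (_ : Ideal.span (Set.range x) ≤ 𝔞), koszulGradeSeq x M

/-! ### The Čech complex -/

/-- The canonical map `R_a → R_b` for `a ∣ b`. -/
noncomputable def awayMap {R : Type u} [CommRing R] {a b : R} (h : a ∣ b) :
    Localization.Away a →ₐ[R] Localization.Away b :=
  IsLocalization.liftAlgHom (M := Submonoid.powers a)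
    (f := Algebra.ofId R (Localization.Away b)) (by
      rintro ⟨_, n, rfl⟩
      have hb : IsUnit (algebraMap R (Localization.Away b) b) :=
        IsLocalization.Away.algebraMap_isUnit b
      have ha : IsUnit (algebraMap R (Localization.Away b) a) :=
        isUnit_of_dvd_unit (map_dvd _ h) hb
      simpa [Algebra.ofId_apply] using ha.pow n)

theorem awayMap_comp {R : Type u} [CommRing R] {a b c : R} (h : a ∣ b) (h' : b ∣ c)
    (z : Localization.Away a) : awayMap h' (awayMap h z) = awayMap (h.trans h') z := by
  have : (awayMap h').comp (awayMap h) = awayMap (h.trans h') :=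
    IsLocalization.algHom_ext (W := Submonoid.powers a) (A := R) (by ext)
  exact DFunLike.congr_fun this z

/-- The Čech cochains of degree `i`: the product of the localizations `R_{x_S}`, `x_S = ∏_{j ∈ S}
x_j`, over the subsets `S` of size `i`. -/
abbrev CechCochain {R : Type u} [CommRing R] {r : ℕ} (x : Fin r → R) (i : ℕ) : Type u :=
  (S : Sub r i) → Localization.Away (∏ j ∈ S.1, x j)

/-- The Čech differential
`(d f)_T = ∑_{j ∈ T} (-1)^{#{k ∈ T | k < j}} (image of f_{T ∖ j} in R_{x_T})`. -/
noncomputable def cechD {R : Type u} [CommRing R] {r : ℕ} (x : Fin r → R) (i : ℕ) :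
    CechCochain x i →ₗ[R] CechCochain x (i + 1) :=
  LinearMap.pi fun T => ∑ j : T.1, sgn T.1 j.1 •
    ((awayMap (Finset.prod_dvd_prod_of_subset (T.del j).1 T.1 x
      (Finset.erase_subset j.1 T.1))).toLinearMap ∘ₗ LinearMap.proj (T.del j))

theorem cechD_apply {R : Type u} [CommRing R] {r : ℕ} (x : Fin r → R) (i : ℕ)
    (f : CechCochain x i) (T : Sub r (i + 1)) :
    cechD x i f T = ∑ j : T.1, sgn T.1 j.1 •
      awayMap (Finset.prod_dvd_prod_of_subset (T.del j).1 T.1 x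
        (Finset.erase_subset j.1 T.1)) (f (T.del j)) := by
  simp [cechD, LinearMap.sum_apply]

theorem cechD_comp {R : Type u} [CommRing R] {r : ℕ} (x : Fin r → R) (i : ℕ) :
    cechD x (i + 1) ∘ₗ cechD x i = 0 := by
  refine LinearMap.ext fun f => funext fun T => ?_
  simp only [LinearMap.comp_apply, cechD_apply, map_sum, map_zsmul, awayMap_comp,
    Finset.smul_sum, smul_smul, LinearMap.zero_apply, Pi.zero_apply]
  refine sum_pairs_eq_zero T.1 (fun p => (sgn T.1 p.1.1 * sgn (T.1.erase p.1.1) p.2.1) •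
    awayMap (Finset.prod_dvd_prod_of_subset ((T.del p.1).del p.2).1 T.1 x
      ((Finset.erase_subset _ _).trans (Finset.erase_subset _ _)))
      (f ((T.del p.1).del p.2))) ?_
  intro j k hj hk h h'
  have he : (T.del ⟨j, hj⟩).del ⟨k, h⟩ = (T.del ⟨k, hk⟩).del ⟨j, h'⟩ :=
    Subtype.ext (Finset.erase_right_comm)
  have key : ∀ (U V : Sub r i) (hU : U.1 ⊆ T.1) (hV : V.1 ⊆ T.1), U = V →
      awayMap (Finset.prod_dvd_prod_of_subset U.1 T.1 x hU) (f U) =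
        awayMap (Finset.prod_dvd_prod_of_subset V.1 T.1 x hV) (f V) := by
    rintro U V hU hV rfl; rfl
  have hs := sgn_swap T.1 hj hk (Finset.ne_of_mem_erase h).symm
  have hsub : ∀ a b : Fin r, (T.1.erase a).erase b ⊆ T.1 := fun a b =>
    (Finset.erase_subset _ _).trans (Finset.erase_subset _ _)
  dsimp only
  rw [key _ _ (hsub j k) (hsub k j) he, hs, neg_smul, neg_add_cancel]

/-- The Čech complex of `R` with respect to the finite sequence `x`. -/
noncomputable abbrev cechComplex {R : Type u} [CommRing R] {r : ℕ} (x : Fin r → R) :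
    CochainComplex (ModuleCat.{u} R) ℕ :=
  CochainComplex.of (fun i => ModuleCat.of R (CechCochain x i))
    (fun i => ModuleCat.ofHom (cechD x i))
    (fun i => by rw [← ModuleCat.ofHom_comp, cechD_comp]; rfl)

/-- The Čech cohomology `H^i_x(R)`. -/
noncomputable abbrev cechCohomology {R : Type u} [CommRing R] {r : ℕ} (x : Fin r → R) (i : ℕ) :
    ModuleCat.{u} R :=
  (cechComplex x).homology i

/-! ### Parameter sequences and Cohen-Macaulay rings -/

/-- `x` is weakly proregular: for each `n > 0` there is `m ≥ n` such that
`H_i(φ^m_n(x)) : H_i(K_•(x^m)) → H_i(K_•(x^n))` vanishes for all `i ≥ 1`. -/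
def IsWeaklyProregular {R : Type u} [CommRing R] {r : ℕ} (x : Fin r → R) : Prop :=
  ∀ n : ℕ, 0 < n → ∃ (m : ℕ) (h : n ≤ m), ∀ i : ℕ, 1 ≤ i →
    HomologicalComplex.homologyMap (koszulPowMap x h) i = 0

/-- Parameter sequences on `R`. -/
structure IsParameterSequence {R : Type u} [CommRing R] {r : ℕ} (x : Fin r → R) : Prop where
  weaklyProregular : IsWeaklyProregular x
  ne_top : Ideal.span (Set.range x) ≠ ⊤
  nontrivial_localization : ∀ (p : Ideal R) [p.IsPrime], Ideal.span (Set.range x) ≤ p →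
    Nontrivial (LocalizedModule p.primeCompl (cechCohomology x r))

/-- Strong parameter sequences on `R`: every initial segment `x₁, …, xᵢ` with `1 ≤ i ≤ r` is a
parameter sequence. -/
def IsStrongParameterSequence {R : Type u} [CommRing R] {r : ℕ} (x : Fin r → R) : Prop :=
  ∀ (i : ℕ) (h : i ≤ r), 1 ≤ i → IsParameterSequence fun k : Fin i => x (Fin.castLE h k)

/-- `R` is Cohen-Macaulay in the sense of Hamilton-Marley: every strong parameter sequence
`x₁, …, x_r` (`r ≥ 1`) is a regular sequence on `R`. -/
def IsCohenMacaulayHM (R : Type u) [CommRing R] : Prop :=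
  ∀ (r : ℕ) (x : Fin r → R), 1 ≤ r → IsStrongParameterSequence x →
    RingTheory.Sequence.IsRegular R (List.ofFn x)

/-- `R` is Cohen-Macaulay in the sense of a class `𝒜` of ideals: height and Koszul grade on `R`
agree for every ideal in `𝒜`. -/
def IsCohenMacaulayFor (R : Type u) [CommRing R] (𝒜 : Set (Ideal R)) : Prop :=
  ∀ 𝔞 ∈ 𝒜, 𝔞.height = koszulGrade 𝔞 R

end NonNoetherianCM

/-!
If the top Čech cohomology of `x₁, …, x_r` is nonzero at every prime containing the ideal `(x)`,
then `(x)` has height at least `r`: at a prime `p ⊇ (x)` of height less than `r`, Coquand and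
Lombardi's elementary characterization of Krull dimension gives relations
`s (x₁ ⋯ x_r)^m ∈ (x₁^(m+1), …, x_r^(m+1))` with `s ∉ p`, and these relations for the powers of the
`x_j` say that the top Čech cohomology vanishes at `p`.

Each initial segment `x₁, …, x_i` therefore has Koszul grade at least `i`, and this makes the
sequence regular: if `x_i m = ∑_{j < i} x_j m_j`, then `m` and the `m_j` are, up to signs, the
components of a Koszul cocycle of degree `i - 1` of `x₁, …, x_i`, and writing it as a coboundary
shows `m ∈ (x₁, …, x_{i-1}) M`.
-/

namespace NonNoetherianCM

universe u

/-! ### Koszul cochains -/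

section KoszulCochains

variable {R M : Type*} [CommRing R] [AddCommGroup M] [Module R M] {r : ℕ}

/-- The differential of the Koszul cochain complex `Hom_R(K_•(x), M)`. Cochains of all degrees are
encoded together, a cochain of degree `i` being read off from the values of a function
`Finset (Fin r) → M` on the sets with `i` elements. -/
def cochainD (x : Fin r → R) : (Finset (Fin r) → M) →ₗ[R] (Finset (Fin r) → M) where
  toFun f T := ∑ j ∈ T, sgn T j • x j • f (T.erase j)
  map_add' f g := by
    ext T
    simp only [Pi.add_apply, smul_add, Finset.sum_add_distrib]
  map_smul' c f := by
    ext T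
    simp only [Pi.smul_apply, RingHom.id_apply, Finset.smul_sum, smul_comm c]

/-- The contraction of a cochain with the basis vector `e_p`, i.e. `e_S ↦ f (e_p ∧ e_S)`. -/
def contract (R : Type*) [CommRing R] [Module R M] (p : Fin r) :
    (Finset (Fin r) → M) →ₗ[R] (Finset (Fin r) → M) where
  toFun f S := if p ∈ S then 0 else sgn (insert p S) p • f (insert p S)
  map_add' f g := by
    ext S
    by_cases hp : p ∈ S <;> simp [hp]
  map_smul' c f := by
    ext S
    by_cases hp : p ∈ S <;> simp [hp, smul_comm c]

/-- The cochain `f + e_p^* ∧ u`, for `f` and `u` restricted to the sets not containing `p`: every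
cochain is of this form, with `u` its contraction with `e_p`. -/
def glue (p : Fin r) (f u : Finset (Fin r) → M) (S : Finset (Fin r)) : M :=
  if p ∈ S then sgn S p • u (S.erase p) else f S

variable {x : Fin r → R} {f g : Finset (Fin r) → M} {A S : Finset (Fin r)} {p : Fin r} {i : ℕ}

theorem cochainD_apply (x : Fin r → R) (f : Finset (Fin r) → M) (T : Finset (Fin r)) :
    cochainD x f T = ∑ j ∈ T, sgn T j • x j • f (T.erase j) := rfl

theorem sgn_mul_self (S : Finset (Fin r)) (j : Fin r) : sgn S j * sgn S j = 1 := by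
  rw [sgn, ← mul_pow, neg_one_mul, neg_neg, one_pow]

theorem sgn_smul_sgn_smul (S : Finset (Fin r)) (j : Fin r) (m : M) :
    sgn S j • sgn S j • m = m := by
  rw [smul_smul, sgn_mul_self, one_smul]

theorem sgn_insert_mul_sgn_insert {j : Fin r} (hj : j ∈ S) (hp : p ∉ S) :
    sgn (insert p S) p * sgn (insert p S) j = -(sgn S j * sgn (insert p (S.erase j)) p) := by
  have hne : p ≠ j := fun h => hp (h ▸ hj)
  have hswap := sgn_swap (insert p S) (Finset.mem_insert_self p S)
    (Finset.mem_insert_of_mem hj) hne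
  rw [Finset.erase_insert hp, Finset.erase_insert_of_ne hne] at hswap
  linear_combination (sgn S j * sgn (insert p S) j) * hswap
    - (sgn (insert p S) p * sgn (insert p S) j) * sgn_mul_self S j
    - (sgn S j * sgn (insert p (S.erase j)) p) * sgn_mul_self (insert p S) j

theorem contract_of_mem (hp : p ∈ S) (f : Finset (Fin r) → M) : contract R p f S = 0 :=
  if_pos hp

theorem contract_of_notMem (hp : p ∉ S) (f : Finset (Fin r) → M) :
    contract R p f S = sgn (insert p S) p • f (insert p S) :=
  if_neg hp

theorem glue_of_notMem (hp : p ∉ S) (f u : Finset (Fin r) → M) : glue p f u S = f S :=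
  if_neg hp

theorem contract_glue (hp : p ∉ S) (f u : Finset (Fin r) → M) :
    contract R p (glue p f u) S = u S := by
  rw [contract_of_notMem hp, glue, if_pos (Finset.mem_insert_self p S), Finset.erase_insert hp,
    sgn_smul_sgn_smul]

/-- Cartan's homotopy formula. -/
theorem contract_cochainD (x : Fin r → R) (f : Finset (Fin r) → M) (p : Fin r)
    (S : Finset (Fin r)) :
    contract R p (cochainD x f) S = x p • f S - cochainD x (contract R p f) S := by
  by_cases hp : p ∈ S
  · have hsum : cochainD x (contract R p f) S = x p • f S := by
      rw [cochainD_apply, Finset.sum_eq_single_of_mem p hp fun k _ hk => ?_,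
        contract_of_notMem (Finset.notMem_erase p S), Finset.insert_erase hp,
        smul_comm (x p), sgn_smul_sgn_smul]
      rw [contract_of_mem (Finset.mem_erase.2 ⟨hk.symm, hp⟩), smul_zero, smul_zero]
    rw [contract_of_mem hp, hsum, sub_self]
  · rw [contract_of_notMem hp, cochainD_apply, Finset.sum_insert hp, Finset.erase_insert hp,
      smul_add, sgn_smul_sgn_smul, sub_eq_add_neg, cochainD_apply, Finset.smul_sum,
      ← Finset.sum_neg_distrib]
    congr 1
    refine Finset.sum_congr rfl fun j hj => ?_
    have hne : p ≠ j := fun h => hp (h ▸ hj)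
    rw [contract_of_notMem fun h => hp (Finset.mem_of_mem_erase h),
      Finset.erase_insert_of_ne hne, smul_comm (x j), smul_smul, smul_smul,
      sgn_insert_mul_sgn_insert hj hp, neg_smul]

theorem cochainD_eqOn_notMem (x : Fin r → R) (h : Set.EqOn f g {S | p ∉ S}) :
    Set.EqOn (cochainD x f) (cochainD x g) {S | p ∉ S} :=
  fun T hT => Finset.sum_congr rfl fun j _ => by
    rw [h (x := T.erase j) fun hp => hT (Finset.mem_of_mem_erase hp)]

theorem powersetCard_subset_notMem (hp : p ∉ A) (i : ℕ) :
    (A.powersetCard i : Set (Finset (Fin r))) ⊆ {S | p ∉ S} :=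
  fun _ hS h => hp ((Finset.mem_powersetCard.1 hS).1 h)

theorem powersetCard_subset_insert (p : Fin r) (A : Finset (Fin r)) (i : ℕ) :
    (A.powersetCard i : Set (Finset (Fin r))) ⊆ (insert p A).powersetCard i :=
  Finset.coe_subset.2 (Finset.powersetCard_mono (Finset.subset_insert p A))

theorem glue_eqOn (p : Fin r) (f u : Finset (Fin r) → M) :
    Set.EqOn (glue p f u) f {S | p ∉ S} :=
  fun _ hS => glue_of_notMem hS f u

theorem contract_cochainD_glue_eqOn (x : Fin r → R) (p : Fin r) (f u : Finset (Fin r) → M) :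
    Set.EqOn (contract R p (cochainD x (glue p f u))) (x p • f - cochainD x u) {S | p ∉ S} := by
  intro S hS
  have hcontract : Set.EqOn (contract R p (glue p f u)) u {S | p ∉ S} :=
    fun _ hS => contract_glue hS f u
  rw [contract_cochainD, glue_eqOn p f u hS, cochainD_eqOn_notMem x hcontract hS, Pi.sub_apply,
    Pi.smul_apply]

variable (R) in
theorem eqOn_powersetCard_insert_iff (hp : p ∉ A) :
    Set.EqOn f g ((insert p A).powersetCard (i + 1)) ↔
      Set.EqOn f g (A.powersetCard (i + 1)) ∧
        Set.EqOn (contract R p f) (contract R p g) (A.powersetCard i) := by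
  rw [Finset.powersetCard_succ_insert hp, Finset.coe_union, Finset.coe_image, Set.eqOn_union,
    ← Set.eqOn_comp_right_iff]
  refine and_congr_right fun _ => forall₂_congr fun S hS => ?_
  have hpS := powersetCard_subset_notMem hp i hS
  rw [contract_of_notMem hpS, contract_of_notMem hpS]
  refine ⟨congrArg _, fun h => ?_⟩
  rw [Function.comp_apply, Function.comp_apply, ← sgn_smul_sgn_smul (insert p S) p (f _), h,
    sgn_smul_sgn_smul]

theorem cochainD_glue_eqOn_insert_iff (hp : p ∉ A) {u : Finset (Fin r) → M} :
    Set.EqOn (cochainD x (glue p f u)) g ((insert p A).powersetCard (i + 1)) ↔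
      Set.EqOn (cochainD x f) g (A.powersetCard (i + 1)) ∧
        Set.EqOn (x p • f - cochainD x u) (contract R p g) (A.powersetCard i) := by
  rw [eqOn_powersetCard_insert_iff R hp]
  have hA := (cochainD_eqOn_notMem x (glue_eqOn p f u)).mono
    (powersetCard_subset_notMem hp (i + 1))
  have hpA := (contract_cochainD_glue_eqOn x p f u).mono (powersetCard_subset_notMem hp i)
  exact and_congr ⟨hA.symm.trans, hA.trans⟩ ⟨hpA.symm.trans, hpA.trans⟩

theorem smul_eqOn_cochainD (hf : Set.EqOn (cochainD x f) 0 (A.powersetCard (i + 1))) {z : R}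
    (hz : z ∈ Ideal.span (x '' A)) :
    ∃ u : Finset (Fin r) → M, Set.EqOn (z • f) (cochainD x u) (A.powersetCard i) := by
  induction hz using Submodule.span_induction with
  | mem z hz =>
    obtain ⟨j, hj, rfl⟩ := hz
    refine ⟨contract R j f, fun S hS => sub_eq_zero.1 ?_⟩
    rw [Pi.smul_apply, ← contract_cochainD]
    by_cases hjS : j ∈ S
    · exact contract_of_mem hjS _
    · obtain ⟨hSA, hSi⟩ := Finset.mem_powersetCard.1 hS
      rw [contract_of_notMem hjS, hf, Pi.zero_apply, smul_zero]
      exact Finset.mem_powersetCard.2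
        ⟨Finset.insert_subset hj hSA, by rw [Finset.card_insert_of_notMem hjS, hSi]⟩
  | zero => exact ⟨0, fun S _ => by rw [zero_smul, map_zero]⟩
  | add a b _ _ ha hb =>
    obtain ⟨⟨u, hu⟩, ⟨v, hv⟩⟩ := ha, hb
    exact ⟨u + v, fun S hS => by
      rw [map_add, add_smul, Pi.add_apply, Pi.add_apply, hu hS, hv hS]⟩
  | smul c a _ ha =>
    obtain ⟨u, hu⟩ := ha
    exact ⟨c • u, fun S hS => by
      rw [map_smul, smul_assoc]
      exact congrArg (c • ·) (hu hS)⟩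

variable (M) in
/-- The Koszul cohomology with coefficients in `M` of the subfamily of `x` indexed by `A` vanishes
in degree `i`. Working with subfamilies of one fixed family avoids reindexing when an element is
adjoined. -/
def KoszulAcyclicAt (x : Fin r → R) (A : Finset (Fin r)) (i : ℕ) : Prop :=
  ∀ f : Finset (Fin r) → M, Set.EqOn (cochainD x f) 0 (A.powersetCard (i + 1)) →
    ∃ g : Finset (Fin r) → M, Set.EqOn f (cochainD x g) (A.powersetCard i)

theorem KoszulAcyclicAt.insert_zero (p : Fin r) (h : KoszulAcyclicAt M x A 0) :
    KoszulAcyclicAt M x (insert p A) 0 := by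
  intro f hf
  obtain ⟨g, hg⟩ := h f (hf.mono (powersetCard_subset_insert p A _))
  refine ⟨g, ?_⟩
  rwa [Finset.powersetCard_zero] at hg ⊢

theorem KoszulAcyclicAt.insert_succ (hp : p ∉ A) (h : KoszulAcyclicAt M x A i)
    (h' : KoszulAcyclicAt M x A (i + 1)) : KoszulAcyclicAt M x (insert p A) (i + 1) := by
  intro f hf
  obtain ⟨hfA, hfp⟩ := (eqOn_powersetCard_insert_iff R hp).1 hf
  obtain ⟨g, hg⟩ := h' f hfA
  have hcocycle : Set.EqOn (cochainD x (x p • g - contract R p f)) 0 (A.powersetCard (i + 1)) := by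
    intro S hS
    rw [map_sub, map_smul, Pi.sub_apply, Pi.smul_apply, ← hg hS, ← contract_cochainD, hfp hS,
      map_zero]
  obtain ⟨u, hu⟩ := h _ hcocycle
  refine ⟨glue p g u, ((cochainD_glue_eqOn_insert_iff hp).2 ⟨hg.symm, fun S hS => ?_⟩).symm⟩
  rw [Pi.sub_apply, ← hu hS, Pi.sub_apply, sub_sub_cancel]

theorem KoszulAcyclicAt.of_insert (hp : p ∉ A) (hx : x p ∈ Ideal.span (x '' A))
    (h : KoszulAcyclicAt M x (insert p A) i) : KoszulAcyclicAt M x A i := by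
  intro f hf
  obtain ⟨u, hu⟩ := smul_eqOn_cochainD hf hx
  obtain ⟨g, hg⟩ := h (glue p f u) ((cochainD_glue_eqOn_insert_iff hp).2 ⟨hf, fun S hS => by
    rw [map_zero, Pi.sub_apply, hu hS, sub_self, Pi.zero_apply]⟩)
  exact ⟨g, ((glue_eqOn p f u).mono (powersetCard_subset_notMem hp i)).symm.trans
    (hg.mono (powersetCard_subset_insert p A i))⟩

theorem forall_koszulAcyclicAt_union (B : Finset (Fin r))
    (h : ∀ j ≤ i, KoszulAcyclicAt M x A j) : ∀ j ≤ i, KoszulAcyclicAt M x (B ∪ A) j := by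
  induction B using Finset.induction_on with
  | empty => rwa [Finset.empty_union]
  | insert p B _ ih =>
    rw [Finset.insert_union]
    by_cases hp : p ∈ B ∪ A
    · rwa [Finset.insert_eq_self.2 hp]
    · rintro (_ | j) hj
      · exact (ih 0 hj).insert_zero p
      · exact (ih j (Nat.le_of_succ_le hj)).insert_succ hp (ih (j + 1) hj)

theorem KoszulAcyclicAt.of_union {B : Finset (Fin r)} (hB : ∀ p ∈ B, x p ∈ Ideal.span (x '' A))
    (h : KoszulAcyclicAt M x (B ∪ A) i) : KoszulAcyclicAt M x A i := by
  induction B using Finset.induction_on with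
  | empty => rwa [Finset.empty_union] at h
  | insert p B _ ih =>
    rw [Finset.forall_mem_insert] at hB
    rw [Finset.insert_union] at h
    refine ih hB.2 ?_
    by_cases hp : p ∈ B ∪ A
    · rwa [Finset.insert_eq_self.2 hp] at h
    · exact h.of_insert hp (Ideal.span_mono
        (Set.image_mono (Finset.coe_subset.2 Finset.subset_union_right)) hB.1)

theorem sgn_map {s : ℕ} (e : Fin r ↪o Fin s) (S : Finset (Fin r)) (j : Fin r) :
    sgn (S.map e.toEmbedding) (e j) = sgn S j := by
  have hlt : (· < e j) ∘ e.toEmbedding = (· < j) := funext fun k => propext e.lt_iff_lt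
  rw [sgn, sgn, Finset.filter_map, Finset.card_map]
  simp only [hlt]

theorem cochainD_comp_map {s : ℕ} (e : Fin r ↪o Fin s) (x : Fin s → R)
    (f : Finset (Fin s) → M) :
    cochainD x f ∘ Finset.map e.toEmbedding =
      cochainD (x ∘ e) (f ∘ Finset.map e.toEmbedding) := by
  ext T
  simp only [Function.comp_apply, cochainD_apply, Finset.sum_map, Finset.map_erase,
    RelEmbedding.coe_toEmbedding, sgn_map]

theorem koszulAcyclicAt_map_iff {s : ℕ} (e : Fin r ↪o Fin s) (x : Fin s → R)
    (A : Finset (Fin r)) (i : ℕ) :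
    KoszulAcyclicAt M x (A.map e.toEmbedding) i ↔ KoszulAcyclicAt M (x ∘ e) A i := by
  have hsurj : Function.Surjective
      fun F : Finset (Fin s) → M => F ∘ Finset.map e.toEmbedding :=
    (Finset.map_injective e.toEmbedding).surjective_comp_right
  have heqOn (F G : Finset (Fin s) → M) (i : ℕ) :
      Set.EqOn F G ((A.map e.toEmbedding).powersetCard i) ↔
        Set.EqOn (F ∘ Finset.map e.toEmbedding) (G ∘ Finset.map e.toEmbedding)
          (A.powersetCard i) := by
    rw [Set.eqOn_comp_right_iff, Finset.powersetCard_map, Finset.coe_map]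
    rfl
  simp only [KoszulAcyclicAt, heqOn, hsurj.forall, hsurj.exists, cochainD_comp_map]
  rfl

/-- Adjoin the elements of `x` to `y` one by one, then discard those of `y`, which are redundant
in the presence of `x`. -/
theorem KoszulAcyclicAt.of_span_le {s : ℕ} {y : Fin s → R}
    (hyx : Ideal.span (Set.range y) ≤ Ideal.span (Set.range x))
    (h : ∀ j ≤ i, KoszulAcyclicAt M y Finset.univ j) : KoszulAcyclicAt M x Finset.univ i := by
  let X : Finset (Fin (r + s)) := Finset.univ.map (Fin.castAddOrderEmb s).toEmbedding
  let Y : Finset (Fin (r + s)) := Finset.univ.map (Fin.natAddOrderEmb r).toEmbedding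
  have hx : Fin.append x y ∘ Fin.castAddOrderEmb s = x := funext (Fin.append_left x y)
  have hy : Fin.append x y ∘ Fin.natAddOrderEmb r = y := funext (Fin.append_right x y)
  have hY : ∀ j ≤ i, KoszulAcyclicAt M (Fin.append x y) Y j := by
    simpa only [Y, koszulAcyclicAt_map_iff, hy] using h
  have hspan : Fin.append x y '' X = Set.range x := by
    simp only [X, Finset.coe_map, Finset.coe_univ, Set.image_univ, ← Set.range_comp]
    exact congrArg Set.range hx
  have hYX : ∀ p ∈ Y, Fin.append x y p ∈ Ideal.span (Fin.append x y '' X) := by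
    rw [hspan]
    exact Finset.forall_mem_map.2 fun k _ => hyx (Ideal.subset_span ⟨k, (congrFun hy k).symm⟩)
  have hYXi : KoszulAcyclicAt M (Fin.append x y) (Y ∪ X) i := by
    rw [Finset.union_comm]
    exact forall_koszulAcyclicAt_union X hY i le_rfl
  have hX := hYXi.of_union hYX
  rwa [koszulAcyclicAt_map_iff, hx] at hX

theorem mem_span_smul_top_iff_exists_cochainD {m : M} :
    m ∈ Ideal.span (x '' A) • (⊤ : Submodule R M) ↔
      ∃ u : Finset (Fin r) → M, m = cochainD x u A := by
  constructor
  · intro hm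
    induction hm using Submodule.smul_induction_on' with
    | smul z hz m _ =>
      have hcocycle : Set.EqOn (cochainD x fun _ => m) 0 (A.powersetCard (A.card + 1)) := by
        rw [Finset.powersetCard_eq_empty.2 A.card.lt_succ_self, Finset.coe_empty]
        exact Set.eqOn_empty _ _
      obtain ⟨u, hu⟩ := smul_eqOn_cochainD hcocycle hz
      exact ⟨u, hu (Finset.mem_powersetCard.2 ⟨subset_rfl, rfl⟩)⟩
    | add m _ n _ hm hn =>
      obtain ⟨⟨u, hu⟩, ⟨v, hv⟩⟩ := hm, hn
      exact ⟨u + v, by rw [map_add, Pi.add_apply, ← hu, ← hv]⟩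
  · rintro ⟨u, rfl⟩
    exact Submodule.sum_mem _ fun j hj => zsmul_mem (Submodule.smul_mem_smul
      (Ideal.subset_span (Set.mem_image_of_mem x hj)) Submodule.mem_top) _

theorem KoszulAcyclicAt.mem_of_smul_mem (hp : p ∉ A)
    (h : KoszulAcyclicAt M x (insert p A) A.card) {m : M}
    (hm : x p • m ∈ Ideal.span (x '' A) • (⊤ : Submodule R M)) :
    m ∈ Ideal.span (x '' A) • (⊤ : Submodule R M) := by
  obtain ⟨u, hu⟩ := mem_span_smul_top_iff_exists_cochainD.1 hm
  have hcocycle : Set.EqOn (cochainD x (glue p (fun _ => m) u)) 0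
      ((insert p A).powersetCard (A.card + 1)) := by
    rw [cochainD_glue_eqOn_insert_iff hp, Finset.powersetCard_self, Finset.coe_singleton,
      Set.eqOn_singleton, Finset.powersetCard_eq_empty.2 A.card.lt_succ_self, Finset.coe_empty,
      map_zero]
    exact ⟨Set.eqOn_empty _ _, sub_eq_zero.2 hu⟩
  obtain ⟨g, hg⟩ := h _ hcocycle
  have hA : A ∈ (insert p A).powersetCard A.card :=
    Finset.mem_powersetCard.2 ⟨Finset.subset_insert p A, rfl⟩
  exact mem_span_smul_top_iff_exists_cochainD.2 ⟨g, (glue_of_notMem hp _ _).symm.trans (hg hA)⟩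

end KoszulCochains

/-! ### Krull dimension and monomial relations -/

section MonomialRelations

variable {R : Type u} [CommRing R]

/-- The multiplicative set of the elements `x ^ k * (1 + a * x)`, whose localization is Coquand and
Lombardi's lower boundary of `x`. -/
def boundaryMonoid (x : R) : Submonoid R where
  carrier := {s | ∃ (k : ℕ) (a : R), x ^ k * (1 + a * x) = s}
  one_mem' := ⟨0, 0, by ring⟩
  mul_mem' := by
    rintro _ _ ⟨k, a, rfl⟩ ⟨l, b, rfl⟩
    exact ⟨k + l, a + b + a * b * x, by ring⟩

theorem not_isMaximal_of_disjoint_boundaryMonoid {x : R} {q : Ideal R}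
    (hq : Disjoint (boundaryMonoid x : Set R) q) : ¬ q.IsMaximal := by
  intro hmax
  have hx : x ∉ q := Set.disjoint_left.1 hq ⟨1, 0, by ring⟩
  obtain ⟨y, z, hz, hyz⟩ := hmax.exists_inv hx
  exact Set.disjoint_left.1 hq ⟨0, -y, by linear_combination -hyz⟩ hz

theorem ringKrullDim_localization_boundaryMonoid_lt {n : ℕ} (h : ringKrullDim R < (n + 1 : ℕ))
    (x : R) : ringKrullDim (Localization (boundaryMonoid x)) < n := by
  rw [ringKrullDim, Order.krullDim_lt_coe_iff] at h ⊢
  intro l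
  let φ : PrimeSpectrum (Localization (boundaryMonoid x)) → PrimeSpectrum R :=
    PrimeSpectrum.comap (algebraMap R (Localization (boundaryMonoid x)))
  have hφ : StrictMono φ := (IsLocalization.orderEmbedding (boundaryMonoid x)
    (Localization (boundaryMonoid x))).strictMono.comp fun _ _ h => h
  have hdisj : Disjoint (boundaryMonoid x : Set R) (φ l.last).asIdeal :=
    ((IsLocalization.isPrime_iff_isPrime_disjoint (boundaryMonoid x)
      (Localization (boundaryMonoid x)) l.last.asIdeal).1 l.last.isPrime).2
  obtain ⟨m, hm, hle⟩ := Ideal.exists_le_maximal _ (φ l.last).isPrime.ne_top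
  have hne : (φ l.last).asIdeal ≠ m := by
    rintro rfl
    exact not_isMaximal_of_disjoint_boundaryMonoid hdisj hm
  have hlength := h ((l.map φ hφ).snoc ⟨m, hm.isPrime⟩ (by
    rw [LTSeries.last_map]
    exact lt_of_le_of_ne hle hne))
  simpa only [RelSeries.snoc_length, LTSeries.map_length, add_lt_add_iff_right] using hlength

theorem prod_pow_mul_mem_span {ι : Type*} {x : ι → R} {T : Finset ι} {n : ℕ} {z : R}
    (hz : z ∈ Ideal.span ((fun i => x i ^ n) '' T)) (k : ℕ) :
    (∏ i ∈ T, x i) ^ k * z ∈ Ideal.span ((fun i => x i ^ (n + k)) '' T) := by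
  induction hz using Submodule.span_induction with
  | mem z hz =>
    obtain ⟨i, hi, rfl⟩ := hz
    obtain ⟨d, hd⟩ := Finset.dvd_prod_of_mem x hi
    rw [hd, show (x i * d) ^ k * x i ^ n = d ^ k * x i ^ (n + k) by ring]
    exact Ideal.mul_mem_left _ _ (Ideal.subset_span (Set.mem_image_of_mem _ hi))
  | zero => rw [mul_zero]; exact Submodule.zero_mem _
  | add a b _ _ ha hb => rw [mul_add]; exact Submodule.add_mem _ ha hb
  | smul c a _ ha =>
    rw [smul_eq_mul, mul_left_comm]
    exact Ideal.mul_mem_left _ c ha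

theorem exists_mul_prod_pow_mem_span_of_localization {ι : Type*} {S : Submonoid R} {x : ι → R}
    {T : Finset ι} {m n : ℕ}
    (h : (∏ i ∈ T, algebraMap R (Localization S) (x i)) ^ m ∈
      Ideal.span ((fun i => algebraMap R (Localization S) (x i) ^ n) '' T)) :
    ∃ s ∈ S, s * (∏ i ∈ T, x i) ^ m ∈ Ideal.span ((fun i => x i ^ n) '' T) := by
  rw [← IsLocalization.algebraMap_mem_map_algebraMap_iff S (Localization S), Ideal.map_span,
    Set.image_image, map_pow, map_prod]
  simpa only [map_pow] using h

theorem exists_prod_pow_mem_span_of_ringKrullDim_lt {ι : Type*} (T : Finset ι) :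
    ∀ {R : Type u} [CommRing R], ringKrullDim R < T.card → ∀ x : ι → R,
      ∃ m : ℕ, (∏ i ∈ T, x i) ^ m ∈ Ideal.span ((fun i => x i ^ (m + 1)) '' T) := by
  classical
  induction T using Finset.induction_on with
  | empty =>
    intro R _ h x
    have hR : Subsingleton R := not_nontrivial_iff_subsingleton.1 fun _ =>
      (ringKrullDim_nonneg_of_nontrivial (R := R)).not_gt h
    refine ⟨0, ?_⟩
    rw [Subsingleton.elim (_ ^ 0) (0 : R)]
    exact Submodule.zero_mem _
  | insert p T hp ih =>
    intro R _ h x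
    rw [Finset.card_insert_of_notMem hp] at h
    obtain ⟨m, hm⟩ := ih (ringKrullDim_localization_boundaryMonoid_lt h (x p))
      fun i => algebraMap R _ (x i)
    obtain ⟨_, ⟨k, a, rfl⟩, hrel⟩ := exists_mul_prod_pow_mem_span_of_localization hm
    refine ⟨m + k, ?_⟩
    have hp_mem : x p ^ (m + k + 1) ∈
        Ideal.span ((fun i => x i ^ (m + k + 1)) '' (insert p T : Finset ι)) :=
      Ideal.subset_span (Set.mem_image_of_mem _ (Finset.mem_insert_self p T))
    have hT_mem := Ideal.span_mono
      (Set.image_mono (Finset.coe_subset.2 (Finset.subset_insert p T)))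
      (prod_pow_mul_mem_span hrel k)
    rw [add_right_comm] at hT_mem
    have hprod : (∏ i ∈ insert p T, x i) ^ (m + k) =
        x p ^ m * ((∏ i ∈ T, x i) ^ k * (x p ^ k * (1 + a * x p) * (∏ i ∈ T, x i) ^ m)) +
          (-(a * (∏ i ∈ T, x i) ^ (m + k))) * x p ^ (m + k + 1) := by
      rw [Finset.prod_insert hp]
      ring
    rw [hprod]
    exact add_mem (Ideal.mul_mem_left _ _ hT_mem) (Ideal.mul_mem_left _ _ hp_mem)

theorem exists_mul_prod_pow_mem_span_of_height_lt {ι : Type*} {T : Finset ι} (p : Ideal R)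
    [p.IsPrime] (h : p.height < T.card) (x : ι → R) :
    ∃ s ∉ p, ∃ m : ℕ,
      s * (∏ i ∈ T, x i) ^ m ∈ Ideal.span ((fun i => x i ^ (m + 1)) '' T) := by
  have hdim : ringKrullDim (Localization.AtPrime p) < T.card := by
    rw [IsLocalization.AtPrime.ringKrullDim_eq_height p]
    exact_mod_cast h
  obtain ⟨m, hm⟩ := exists_prod_pow_mem_span_of_ringKrullDim_lt T hdim fun i => algebraMap R _ (x i)
  obtain ⟨s, hs, hrel⟩ := exists_mul_prod_pow_mem_span_of_localization hm
  exact ⟨s, hs, m, hrel⟩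

end MonomialRelations

/-! ### Koszul grade -/

section KoszulGrade

variable {R M : Type u} [CommRing R] [AddCommGroup M] [Module R M] {r : ℕ}

theorem linearCombination_koszulD_single (x : Fin r → R) (i : ℕ) (f : Finset (Fin r) → M)
    (T : Sub r (i + 1)) :
    Finsupp.linearCombination R (fun S : Sub r i => f S.1) (koszulD x i (Finsupp.single T 1)) =
      cochainD x f T.1 := by
  rw [koszulD_single, map_sum, cochainD_apply,
    ← Finset.sum_coe_sort T.1 fun j => sgn T.1 j • x j • f (T.1.erase j)]
  refine Finset.sum_congr rfl fun j _ => ?_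
  rw [Finsupp.linearCombination_single, one_mul, mul_smul, Int.cast_smul_eq_zsmul]

theorem linearCombination_comp_koszulD_eq_iff (x : Fin r → R) (i : ℕ)
    (f g : Finset (Fin r) → M) :
    Finsupp.linearCombination R (fun S : Sub r i => f S.1) ∘ₗ koszulD x i =
        Finsupp.linearCombination R (fun S : Sub r (i + 1) => g S.1) ↔
      Set.EqOn (cochainD x f) g ((Finset.univ : Finset (Fin r)).powersetCard (i + 1)) := by
  have hsingle (T : Sub r (i + 1)) :
      Finsupp.linearCombination R (fun S : Sub r (i + 1) => g S.1) (Finsupp.single T 1) =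
        g T.1 := by
    rw [Finsupp.linearCombination_single, one_smul]
  constructor
  · intro h T hT
    let T' : Sub r (i + 1) := ⟨T, Finset.mem_powersetCard_univ.1 hT⟩
    rw [← hsingle T', ← h, LinearMap.comp_apply, linearCombination_koszulD_single]
  · refine fun h => Finsupp.lhom_ext' fun T => LinearMap.ext_ring ?_
    rw [LinearMap.comp_apply, LinearMap.comp_apply, LinearMap.comp_apply, Finsupp.lsingle_apply,
      hsingle, linearCombination_koszulD_single]
    exact h (Finset.mem_coe.2 (Finset.mem_powersetCard_univ.2 T.2))

theorem exists_linearCombination_eq {i : ℕ} (ψ : (Sub r i →₀ R) →ₗ[R] M) :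
    ∃ g : Finset (Fin r) → M, Finsupp.linearCombination R (fun S : Sub r i => g S.1) = ψ := by
  obtain ⟨g, hg⟩ := Subtype.val_injective.surjective_comp_right
    fun S : Sub r i => ψ (Finsupp.single S 1)
  refine ⟨g, Finsupp.lhom_ext' fun S => LinearMap.ext_ring ?_⟩
  rw [LinearMap.comp_apply, LinearMap.comp_apply, Finsupp.lsingle_apply,
    Finsupp.linearCombination_single, one_smul]
  exact congrFun hg S

theorem exists_d_comp_eq_of_subsingleton_homology {K : ChainComplex (ModuleCat.{u} R) ℕ}
    {Y : ModuleCat.{u} R} {i : ℕ} (h : Subsingleton ((K.linearYonedaObj R Y).homology i))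
    {φ : K.X i ⟶ Y} (hφ : K.d (i + 1) i ≫ φ = 0) :
    ∃ ψ : K.X (i - 1) ⟶ Y, K.d i (i - 1) ≫ ψ = φ := by
  have hprev : (ComplexShape.up ℕ).prev i = i - 1 := by
    cases i with
    | zero => exact CochainComplex.prev_nat_zero
    | succ i => exact CochainComplex.prev_nat_succ i
  have hexact : (K.linearYonedaObj R Y).ExactAt i := by
    rw [HomologicalComplex.exactAt_iff_isZero_homology]
    exact ModuleCat.isZero_of_subsingleton _
  rw [HomologicalComplex.exactAt_iff' _ (i - 1) i (i + 1) hprev (CochainComplex.next ℕ i),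
    ShortComplex.moduleCat_exact_iff] at hexact
  exact hexact φ hφ

theorem koszulAcyclicAt_of_subsingleton_koszulCohomology {x : Fin r → R} {i : ℕ}
    (h : Subsingleton (koszulCohomology x M i)) : KoszulAcyclicAt M x Finset.univ i := by
  intro f hf
  let φ : (koszulComplex x).X i ⟶ ModuleCat.of R M :=
    ModuleCat.ofHom (Finsupp.linearCombination R fun S : Sub r i => f S.1)
  have hφ : (koszulComplex x).d (i + 1) i ≫ φ = 0 := by
    rw [← linearCombination_comp_koszulD_eq_iff] at hf
    rw [koszulComplex_d]
    exact ModuleCat.hom_ext (hf.trans (Finsupp.linearCombination_zero _ _ _))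
  obtain ⟨ψ, hψ⟩ := exists_d_comp_eq_of_subsingleton_homology h hφ
  cases i with
  | zero =>
    rw [(koszulComplex x).shape 0 0 (by simp), Limits.zero_comp] at hψ
    refine ⟨0, fun S hS => ?_⟩
    have hS' := congrArg (fun χ => χ.hom (Finsupp.single
      (⟨S, Finset.mem_powersetCard_univ.1 hS⟩ : Sub r 0) (1 : R))) hψ
    rw [map_zero, Pi.zero_apply, ← one_smul R (f S)]
    exact (hS'.trans (Finsupp.linearCombination_single R _ _)).symm
  | succ i =>
    let ψ' : (Sub r i →₀ R) →ₗ[R] M := ψ.hom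
    have hψ' : ψ' ∘ₗ koszulD x i =
        Finsupp.linearCombination R fun S : Sub r (i + 1) => f S.1 := by
      rw [← ModuleCat.hom_ofHom (koszulD x i), ← koszulComplex_d]
      exact congrArg ModuleCat.Hom.hom hψ
    obtain ⟨g, hg⟩ := exists_linearCombination_eq ψ'
    exact ⟨g, ((linearCombination_comp_koszulD_eq_iff x i g f).1 (hg ▸ hψ')).symm⟩

theorem koszulAcyclicAt_of_lt_koszulGradeSeq {x : Fin r → R} {i : ℕ}
    (h : i < koszulGradeSeq x M) : KoszulAcyclicAt M x Finset.univ i := by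
  refine koszulAcyclicAt_of_subsingleton_koszulCohomology
    (not_nontrivial_iff_subsingleton.1 fun hn => h.not_ge ?_)
  exact iInf₂_le (f := fun (j : ℕ) (_ : Nontrivial (koszulCohomology x M j)) => (j : ℕ∞)) i hn

theorem koszulAcyclicAt_of_lt_koszulGrade {x : Fin r → R} {i : ℕ}
    (h : i < koszulGrade (Ideal.span (Set.range x)) M) : KoszulAcyclicAt M x Finset.univ i := by
  simp only [koszulGrade, lt_iSup_iff] at h
  obtain ⟨s, y, hyx, hy⟩ := h
  exact KoszulAcyclicAt.of_span_le hyx fun j hj =>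
    koszulAcyclicAt_of_lt_koszulGradeSeq ((Nat.cast_le.2 hj).trans_lt hy)

end KoszulGrade

/-! ### Top Čech cohomology -/

section CechCohomology

variable {R : Type u} [CommRing R] {r : ℕ}

theorem subsingleton_localizedModule_homology {ι : Type*} {c : ComplexShape ι}
    (K : HomologicalComplex (ModuleCat.{u} R) c) (i j : ι) (S : Submonoid R)
    (h : ∀ z : K.X j, ∃ s ∈ S, s • z ∈ LinearMap.range (K.d i j).hom) :
    Subsingleton (LocalizedModule S (K.homology j)) := by
  rw [LocalizedModule.subsingleton_iff]
  intro w
  obtain ⟨z, rfl⟩ := (ModuleCat.epi_iff_surjective (K.homologyπ j)).1 inferInstance w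
  obtain ⟨s, hs, y, hy⟩ := h (K.iCycles j z)
  refine ⟨s, hs, ?_⟩
  have hcycles : s • z = K.toCycles i j y := by
    apply (ModuleCat.mono_iff_injective (K.iCycles j)).1 inferInstance
    rw [map_smul, ← hy, ← ModuleCat.comp_apply, K.toCycles_i]
  rw [← map_smul, hcycles, ← ModuleCat.comp_apply, K.toCycles_comp_homologyπ]
  rfl

theorem awayMap_invSelf {a b d : R} (h : a ∣ b) (hd : d * a = b) :
    awayMap h (IsLocalization.Away.invSelf a) = d • IsLocalization.Away.invSelf b := by
  refine left_inv_eq_right_inv (a := algebraMap R (Localization.Away b) a) ?_ ?_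
  · rw [← AlgHom.commutes (awayMap h), ← map_mul, mul_comm, IsLocalization.Away.mul_invSelf,
      map_one]
  · rw [Algebra.smul_def, ← mul_assoc, ← map_mul, mul_comm a, hd, IsLocalization.Away.mul_invSelf]

theorem pow_smul_invSelf_pow_add (a : R) (k n : ℕ) :
    a ^ k • (IsLocalization.Away.invSelf a : Localization.Away a) ^ (k + n) =
      IsLocalization.Away.invSelf a ^ n := by
  rw [Algebra.smul_def, pow_add, ← mul_assoc, map_pow, ← mul_pow, IsLocalization.Away.mul_invSelf,
    one_pow, one_mul]

theorem exists_smul_invSelf_pow_eq {a : R} (z : Localization.Away a) :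
    ∃ (b : R) (n : ℕ), b • IsLocalization.Away.invSelf a ^ n = z := by
  obtain ⟨n, b, hb⟩ := IsLocalization.Away.surj a z
  refine ⟨b, n, ?_⟩
  rw [Algebra.smul_def, ← hb, mul_assoc, ← mul_pow, IsLocalization.Away.mul_invSelf, one_pow,
    mul_one]

theorem cechD_single_del (x : Fin r → R) {i : ℕ} (T : Sub r (i + 1)) (j : T.1)
    (z : Localization.Away (∏ k ∈ (T.del j).1, x k)) :
    cechD x i (Pi.single (T.del j) z) T = sgn T.1 j.1 •
      awayMap (Finset.prod_dvd_prod_of_subset _ _ x (Finset.erase_subset j.1 T.1)) z := by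
  rw [cechD_apply, Finset.sum_eq_single_of_mem j (Finset.mem_univ j) fun k _ hk => ?_,
    Pi.single_eq_same]
  have hne : T.del k ≠ T.del j := fun h =>
    hk (Subtype.ext (Finset.erase_injOn T.1 k.2 j.2 (congrArg Subtype.val h)))
  rw [Pi.single_eq_of_ne hne, map_zero, zsmul_zero]

theorem smul_invSelf_pow_mem_range_cechD {x : Fin r → R} {i : ℕ} (T : Sub r (i + 1)) {n : ℕ}
    {a : R} (ha : a ∈ Ideal.span ((fun j => x j ^ n) '' (T.1 : Set (Fin r)))) :
    a • IsLocalization.Away.invSelf (∏ j ∈ T.1, x j) ^ n ∈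
      LinearMap.range (LinearMap.proj T ∘ₗ cechD x i) := by
  induction ha using Submodule.span_induction with
  | mem a ha =>
    obtain ⟨j, hj, rfl⟩ := ha
    refine ⟨Pi.single (T.del ⟨j, hj⟩) (sgn T.1 j •
      IsLocalization.Away.invSelf (∏ k ∈ T.1.erase j, x k) ^ n), ?_⟩
    rw [LinearMap.comp_apply, LinearMap.proj_apply, cechD_single_del, map_zsmul,
      sgn_smul_sgn_smul, map_pow, awayMap_invSelf _ (Finset.mul_prod_erase T.1 x hj), smul_pow]
  | zero => rw [zero_smul]; exact Submodule.zero_mem _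
  | add a b _ _ ha hb => rw [add_smul]; exact Submodule.add_mem _ ha hb
  | smul c a _ ha => rw [smul_assoc]; exact Submodule.smul_mem _ c ha

theorem exists_smul_mem_range_cechD (x : Fin r → R) {i : ℕ} (T : Sub r (i + 1)) {p : Ideal R}
    [p.IsPrime] (h : p.height < (i + 1 : ℕ)) (z : Localization.Away (∏ j ∈ T.1, x j)) :
    ∃ s ∉ p, s • z ∈ LinearMap.range (LinearMap.proj T ∘ₗ cechD x i) := by
  obtain ⟨a, n, rfl⟩ := exists_smul_invSelf_pow_eq z
  rw [← T.2] at h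
  obtain ⟨s, hs, m, hrel⟩ := exists_mul_prod_pow_mem_span_of_height_lt p h fun j => x j ^ n
  refine ⟨s, hs, ?_⟩
  simp only [← pow_mul, Finset.prod_pow] at hrel
  have hmem := smul_invSelf_pow_mem_range_cechD T (Ideal.mul_mem_left _ a hrel)
  rwa [mul_add, mul_one, mul_smul, mul_smul, pow_smul_invSelf_pow_add, smul_comm a s] at hmem

theorem cechComplex_d (x : Fin r → R) (i : ℕ) :
    (cechComplex x).d i (i + 1) = ModuleCat.ofHom (cechD x i) :=
  CochainComplex.of_d (fun i => ModuleCat.of R (CechCochain x i))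
    (fun i => ModuleCat.ofHom (cechD x i)) i

theorem subsingleton_localizedModule_cechCohomology {x : Fin (r + 1) → R} {p : Ideal R}
    [p.IsPrime] (h : p.height < (r + 1 : ℕ)) :
    Subsingleton (LocalizedModule p.primeCompl (cechCohomology x (r + 1))) := by
  refine subsingleton_localizedModule_homology (cechComplex x) r (r + 1) _ fun z => ?_
  have hunique : ∀ T : Sub (r + 1) (r + 1), T = ⟨Finset.univ, Finset.card_fin _⟩ := fun T =>
    Subtype.ext ((Finset.card_eq_iff_eq_univ T.1).1 (T.2.trans (Fintype.card_fin _).symm))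
  let z' : CechCochain x (r + 1) := z
  obtain ⟨s, hs, y, hy⟩ := exists_smul_mem_range_cechD x _ h
    (z' ⟨Finset.univ, Finset.card_fin _⟩)
  refine ⟨s, hs, y, ?_⟩
  rw [cechComplex_d]
  funext T
  obtain rfl := hunique T
  exact hy

theorem le_height_of_nontrivial_localizedModule_cechCohomology {x : Fin r → R}
    (h : ∀ (p : Ideal R) [p.IsPrime], Ideal.span (Set.range x) ≤ p →
      Nontrivial (LocalizedModule p.primeCompl (cechCohomology x r))) :
    r ≤ (Ideal.span (Set.range x)).height := by
  cases r with
  | zero => exact zero_le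
  | succ r =>
    rw [Ideal.height_eq_inf_minimalPrimes]
    refine le_iInf₂ fun p hp => not_lt.1 fun hlt => ?_
    have : p.IsPrime := hp.1.1
    exact not_subsingleton_iff_nontrivial.2 (h p hp.1.2)
      (subsingleton_localizedModule_cechCohomology hlt)

end CechCohomology

/-! ### Regular sequences -/

section RegularSequences

variable {R M : Type u} [CommRing R] [AddCommGroup M] [Module R M] {r : ℕ}

theorem ofList_ofFn (x : Fin r → R) : Ideal.ofList (List.ofFn x) = Ideal.span (Set.range x) := by
  simp only [Ideal.ofList, List.mem_ofFn]
  rfl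

theorem mem_span_smul_top_of_lt_koszulGrade {x : Fin (r + 1) → R}
    (h : r < koszulGrade (Ideal.span (Set.range x)) M) {m : M}
    (hm : x (Fin.last r) • m ∈ Ideal.span (Set.range (Fin.init x)) • (⊤ : Submodule R M)) :
    m ∈ Ideal.span (Set.range (Fin.init x)) • (⊤ : Submodule R M) := by
  let A : Finset (Fin (r + 1)) := Finset.univ.map Fin.castSuccEmb
  have hA : Set.range (Fin.init x) = x '' A := by
    rw [Finset.coe_map, Finset.coe_univ, Set.image_univ, ← Set.range_comp]
    rfl
  have hlast : Fin.last r ∉ A := fun h =>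
    let ⟨j, _, hj⟩ := Finset.mem_map.1 h
    j.castSucc_ne_last hj
  have hacyclic : KoszulAcyclicAt M x (insert (Fin.last r) A) A.card := by
    rw [← Finset.cons_eq_insert _ _ hlast, ← Fin.univ_castSuccEmb, Finset.card_map,
      Finset.card_fin]
    exact koszulAcyclicAt_of_lt_koszulGrade h
  rw [hA] at hm ⊢
  exact hacyclic.mem_of_smul_mem hlast hm

theorem isWeaklyRegular_ofFn_of_lt_koszulGrade {x : Fin r → R}
    (h : ∀ (i : ℕ) (hi : i + 1 ≤ r),
      i < koszulGrade (Ideal.span (Set.range (Fin.take (i + 1) hi x))) M) :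
    RingTheory.Sequence.IsWeaklyRegular M (List.ofFn x) := by
  rw [RingTheory.Sequence.isWeaklyRegular_iff_Fin]
  intro i
  have hi : i.1 + 1 ≤ r := i.2.trans_eq List.length_ofFn
  have hx : (List.ofFn x)[i] = Fin.take (i.1 + 1) hi x (Fin.last i.1) := List.getElem_ofFn _
  rw [isSMulRegular_quotient_iff_mem_of_smul_mem,
    ← Fin.ofFn_take_eq_take_ofFn (Nat.le_of_succ_le hi), ofList_ofFn, hx]
  exact fun m hm => mem_span_smul_top_of_lt_koszulGrade (h i hi) hm

end RegularSequences

end NonNoetherianCM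

open NonNoetherianCM in
theorem theorem3p4_general.{u} {R M : Type u} [CommRing R] [AddCommGroup M] [Module R M]
    (hM : ∀ 𝔞 : Ideal R, 𝔞.FG → 𝔞.height ≤ koszulGrade 𝔞 M) {r : ℕ} (x : Fin r → R)
    (hx : ∀ (i : ℕ) (hi : i ≤ r), 1 ≤ i → ∀ (p : Ideal R) [p.IsPrime],
      Ideal.span (Set.range (Fin.take i hi x)) ≤ p →
        Nontrivial (LocalizedModule p.primeCompl (cechCohomology (Fin.take i hi x) i)))
    (htop : (⊤ : Submodule R M) ≠ Ideal.span (Set.range x) • ⊤) :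
    RingTheory.Sequence.IsRegular M (List.ofFn x) := by
  refine ⟨isWeaklyRegular_ofFn_of_lt_koszulGrade fun i hi => ?_, by rwa [ofList_ofFn]⟩
  let 𝔞 := Ideal.span (Set.range (Fin.take (i + 1) hi x))
  calc (i : ℕ∞) < (i + 1 : ℕ) := Nat.cast_lt.2 i.lt_succ_self
    _ ≤ 𝔞.height :=
      le_height_of_nontrivial_localizedModule_cechCohomology (hx (i + 1) hi i.succ_pos)
    _ ≤ koszulGrade 𝔞 M := hM 𝔞 (Submodule.fg_span (Set.finite_range _))

theorem theorem3p4 {R : Type*} [CommRing R]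
    (hR : NonNoetherianCM.IsCohenMacaulayFor R {𝔞 : Ideal R | 𝔞.FG}) :
    NonNoetherianCM.IsCohenMacaulayHM R :=
  fun r x hr hx => theorem3p4_general (fun 𝔞 h𝔞 => (hR 𝔞 h𝔞).le) x
    (fun i hi hi1 => (hx i hi hi1).nontrivial_localization)
    (by rw [smul_eq_mul, Ideal.mul_top]; exact (hx r le_rfl hr).ne_top.symm)
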